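/- Work in a second-order set theory over the universe $V$ of sets. Let $\kappa\le\theta$ be cardinals. A $\theta$-supercompactness embedding with critical point $\kappa$ is an elementary embedding $j\colon V\to M$ (for the language $\{\in\}$) into a transitive class $M$ containing all ordinals such that $\kappa$ is the least ordinal moved by $j$, $\theta<j(\kappa)$, and every function from $\theta$ to $M$ is an element of $M$. A function $\ell\colon\kappa\to V_\kappa$ guesses $a$ via $j$ if $j(\ell)(\kappa)=a$. Let $H_{\theta^+}$ be the set of all sets whose transitive closure has size at most $\theta$. A function $\ell\colon\kappa\to V_\kappa$ is a $\theta$-supercompactness Laver function for $\kappa$ if every $a\in H_{\theta^+}$ is guessed by $\ell$ via some $\theta$-supercompactness embedding with critical point $\kappa$. A sequence $\langle\ell_\alpha;\alpha<\lambda\rangle$ of $\theta$-supercompactness Laver functions for $\kappa$ is a $\theta$-supercompactness joint Laver sequence for $\kappa$ of length $\lambda$ if for every sequence $\langle a_\alpha;\alpha<\lambda\rangle$ of elements of $H_{\theta^+}$ there is a single $\theta$-supercompactness embedding $j$ with critical point $\kappa$ such that $j(\ell_\alpha)(\kappa)=a_\alpha$ for all $\alpha<\lambda$. Proposition. (1)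 If there is a $\theta$-supercompactness Laver function for $\kappa$, then there is a $\theta$-supercompactness joint Laver sequence for $\kappa$ of length $\lambda=\min\{\theta,2^\kappa\}$. (2) More precisely, let $\ell$ be a $\theta$-supercompactness Laver function for $\kappa$, let $\lambda=\min\{\theta,2^\kappa\}$, and let $f\colon\lambda\to\mathcal P(\kappa)$ be injective. For $\alpha<\lambda$ and $\xi<\kappa$ let $\ell_\alpha(\xi)=\ell(\xi)(f(\alpha)\cap\xi)$ if $\ell(\xi)$ is a function with $f(\alpha)\cap\xi$ in its domain, and $\ell_\alpha(\xi)=\emptyset$ otherwise. Then $\langle\ell_\alpha;\alpha<\lambda\rangle$ is a $\theta$-supercompactness joint Laver sequence for $\kappa$. (3) If some $\ell$ is a $\theta'$-supercompactness Laver function for $\kappa$ for every cardinal $\theta'\ge\kappa$, then there is a sequence of length $2^\kappa$ which is a $\theta'$-supercompactness joint Laver sequence for $\kappa$ for every cardinal $\theta'\ge\kappa$. -/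

import Mathlib

open FirstOrder

universe u

namespace JointLaver

/-- The relation symbols of the language of set theory: a single binary symbol. -/
inductive MemRel : ℕ → Type
  | mem : MemRel 2

/-- The first-order language of set theory `{∈}`. -/
def setLang : FirstOrder.Language.{0, 0} := ⟨fun _ => Empty, MemRel⟩

/-- The universe of sets `V = ZFSet`, as a structure for the language of set theory. -/
instance instStructureV : setLang.Structure ZFSet.{u} where
  funMap := fun f => f.elim
  RelMap := fun {_} r =>
    match r with
    | .mem => fun v => v 0 ∈ v 1

/-- A class `M` of sets with the true membership relation, as a structure for the language of
set theory. -/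
instance instStructureClass (M : Set ZFSet.{u}) : setLang.Structure M where
  funMap := fun f => f.elim
  RelMap := fun {_} r =>
    match r with
    | .mem => fun v => (v 0 : ZFSet.{u}) ∈ (v 1 : ZFSet.{u})

/-- A cardinal, as a von Neumann (initial) ordinal in `ZFSet`. -/
noncomputable def cardSet (κ : Cardinal.{u}) : ZFSet.{u} := κ.ord.toZFSet

/-- `x ∈ H_μ`: the transitive closure of `x` has size less than `μ`; equivalently, `x` is
included in some transitive set of size less than `μ`. -/
def InH (μ : Cardinal.{u}) (x : ZFSet.{u}) : Prop :=
  ∃ t : ZFSet.{u}, t.IsTransitive ∧ x ⊆ t ∧ t.card < μ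

/-- `j : V → M` is a `θ`-supercompactness embedding with critical point `κ`. That `j` is
elementary for the language of set theory is part of the type of `j`; with the first two fields
this makes `M` an inner model of ZFC. -/
structure IsSupercompactnessEmbedding (κ θ : Cardinal.{u}) (M : Set ZFSet.{u})
    (j : ZFSet.{u} ↪ₑ[setLang] M) : Prop where
  /-- `M` is transitive. -/
  transitive : ∀ x ∈ M, ∀ y ∈ x, y ∈ M
  /-- `M` contains all ordinals. -/
  ordinals : ∀ o : Ordinal.{u}, o.toZFSet ∈ M
  /-- Ordinals below `κ` are fixed by `j`. -/
  fix : ∀ o < κ.ord, (j o.toZFSet : ZFSet.{u}) = o.toZFSet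
  /-- `κ` is moved by `j`. -/
  move : (j (cardSet κ) : ZFSet.{u}) ≠ cardSet κ
  /-- `θ < j(κ)`. -/
  lt_image : cardSet θ ∈ (j (cardSet κ) : ZFSet.{u})
  /-- `M` is closed under `θ`-sequences: each function from `θ` to a set of elements of `M` is an
  element of `M`. -/
  closed : ∀ D s : ZFSet.{u}, (∀ y ∈ D, y ∈ M) → ZFSet.IsFunc (cardSet θ) D s → s ∈ M

/-- `ℓ` guesses `a` via `j`, that is `j(ℓ)(κ) = a`. -/
def Guesses (κ : Cardinal.{u}) {M : Set ZFSet.{u}} (j : ZFSet.{u} ↪ₑ[setLang] M)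
    (ℓ a : ZFSet.{u}) : Prop :=
  ZFSet.pair (cardSet κ) a ∈ (j ℓ : ZFSet.{u})

/-- `ℓ : κ → V_κ` is a `θ`-supercompactness Laver function for `κ`: each target in `H_{θ⁺}` is
guessed by `ℓ` via some `θ`-supercompactness embedding with critical point `κ`. -/
def IsLaverFunction (κ θ : Cardinal.{u}) (ℓ : ZFSet.{u}) : Prop :=
  ZFSet.IsFunc (cardSet κ) (ZFSet.vonNeumann κ.ord) ℓ ∧
  ∀ a : ZFSet.{u}, InH (Order.succ θ) a →
    ∃ (M : Set ZFSet.{u}) (j : ZFSet.{u} ↪ₑ[setLang] M),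
      IsSupercompactnessEmbedding κ θ M j ∧ Guesses κ j ℓ a

/-- `L = ⟨ℓ_α ; α < Λ⟩` is a `θ`-supercompactness joint Laver sequence for `κ` of length `Λ`. -/
def IsJointLaverSequence (κ θ : Cardinal.{u}) (Λ : Ordinal.{u})
    (L : Set.Iio Λ → ZFSet.{u}) : Prop :=
  (∀ α, IsLaverFunction κ θ (L α)) ∧
  ∀ a : Set.Iio Λ → ZFSet.{u}, (∀ α, InH (Order.succ θ) (a α)) →
    ∃ (M : Set ZFSet.{u}) (j : ZFSet.{u} ↪ₑ[setLang] M),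
      IsSupercompactnessEmbedding κ θ M j ∧ ∀ α, Guesses κ j (L α) (a α)

/-- `g` is a function: a single-valued set of ordered pairs. -/
def IsFunction (g : ZFSet.{u}) : Prop :=
  (∀ z ∈ g, ∃ x y, z = ZFSet.pair x y) ∧
  ∀ x y y', ZFSet.pair x y ∈ g → ZFSet.pair x y' ∈ g → y = y'

open Classical in
/-- `g(x)` if `g` is a function with `x` in its domain, and `∅` otherwise. -/
noncomputable def eval (g x : ZFSet.{u}) : ZFSet.{u} :=
  if h : IsFunction g ∧ ∃ y, ZFSet.pair x y ∈ g then h.2.choose else ∅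

/-- For `A ⊆ κ`, the function on `κ` given by `ξ ↦ ℓ(ξ)(A ∩ ξ)` if this makes sense and `ξ ↦ ∅`
otherwise. -/
noncomputable def slice (κ : Cardinal.{u}) (ℓ A : ZFSet.{u}) : ZFSet.{u} :=
  ZFSet.range fun ξ : Set.Iio κ.ord =>
    ZFSet.pair ξ.1.toZFSet (eval (eval ℓ ξ.1.toZFSet) (A ∩ ξ.1.toZFSet))

end JointLaver

/-! Code the targets into one. Given `a_α`, the function `g = {(f(α), a_α)}` lies in `H_{θ⁺}`, since
it has at most `θ` elements and each `f(α) ⊆ κ ≤ θ`, so `ℓ` guesses `g` via some `j`. Since `j`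
fixes every ordinal below `κ`, `j(f(α)) ∩ κ = f(α)` (`image_inter`), and elementarity gives
`j(ℓ_α)(κ) = j(ℓ)(κ)(j(f(α)) ∩ κ) = g(f(α)) = a_α` (`guesses_slice`). Injectivity of `f` is what
makes `g` a function.

For all degrees at once, work at degree `max θ (2 ^ κ)`, where sequences of length `2 ^ κ` are short
enough to be coded, and return to `θ`: an embedding of larger degree is also one of smaller degree
(`IsSupercompactnessEmbedding.mono`).

Elementarity is used through formulas with bounded quantifiers, which mean the same in `V` and in
`M`, and once, in `restrict_mem`, through a `∀∀∃` sentence over such a formula. -/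

namespace JointLaver

open FirstOrder.Language Cardinal

/-! ### Absoluteness of bounded formulas -/

/-- A predicate on tuples of sets given by a formula of set theory that has the same meaning in `V`
and in all transitive classes. -/
def IsAbsolute {n : ℕ} (P : (Fin n → ZFSet.{u}) → Prop) : Prop :=
  ∃ φ : setLang.BoundedFormula Empty n,
    (∀ v : Fin n → ZFSet.{u}, φ.Realize Empty.elim v ↔ P v) ∧
    ∀ M : Set ZFSet.{u}, (∀ x ∈ M, ∀ y ∈ x, y ∈ M) →
      ∀ v : Fin n → M, φ.Realize Empty.elim v ↔ P fun i => v i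

namespace IsAbsolute

variable {n : ℕ} {P Q : (Fin n → ZFSet.{u}) → Prop}

theorem congr (hP : IsAbsolute P) (h : ∀ v, Q v ↔ P v) : IsAbsolute Q := by
  rwa [funext fun v => propext (h v)]

theorem mem (i k : Fin n) : IsAbsolute fun v : Fin n → ZFSet.{u} => v i ∈ v k :=
  ⟨Relations.boundedFormula (L := setLang) MemRel.mem ![Term.var (Sum.inr i), Term.var (Sum.inr k)],
    fun _ => Iff.rfl, fun _ _ _ => Iff.rfl⟩

theorem eq (i k : Fin n) : IsAbsolute fun v : Fin n → ZFSet.{u} => v i = v k :=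
  ⟨Term.bdEqual (L := setLang) (Term.var (Sum.inr i)) (Term.var (Sum.inr k)),
    fun _ => Iff.rfl, fun _ _ _ => Subtype.ext_iff⟩

theorem imp (hP : IsAbsolute P) (hQ : IsAbsolute Q) : IsAbsolute fun v => P v → Q v := by
  obtain ⟨φ, hφ, hφ'⟩ := hP
  obtain ⟨ψ, hψ, hψ'⟩ := hQ
  refine ⟨φ.imp ψ, fun v => ?_, fun M hM v => ?_⟩
  · rw [BoundedFormula.realize_imp, hφ, hψ]
  · rw [BoundedFormula.realize_imp, hφ' M hM, hψ' M hM]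

theorem not (hP : IsAbsolute P) : IsAbsolute fun v => ¬ P v := by
  obtain ⟨φ, hφ, hφ'⟩ := hP
  refine ⟨φ.not, fun v => ?_, fun M hM v => ?_⟩
  · rw [BoundedFormula.realize_not, hφ]
  · rw [BoundedFormula.realize_not, hφ' M hM]

theorem and (hP : IsAbsolute P) (hQ : IsAbsolute Q) : IsAbsolute fun v => P v ∧ Q v :=
  (hP.imp hQ.not).not.congr fun v => by tauto

theorem or (hP : IsAbsolute P) (hQ : IsAbsolute Q) : IsAbsolute fun v => P v ∨ Q v :=
  (hP.not.imp hQ).congr fun v => by tauto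

theorem ball {P : (Fin n → ZFSet.{u}) → ZFSet.{u} → Prop} (i : Fin n)
    (hP : IsAbsolute fun w : Fin (n + 1) → ZFSet.{u} =>
      P (fun k => w k.castSucc) (w (Fin.last n))) :
    IsAbsolute fun v => ∀ x ∈ v i, P v x := by
  obtain ⟨φ, hφ, hφ'⟩ := (mem (Fin.last n) i.castSucc).imp hP
  refine ⟨φ.all, fun v => ?_, fun M hM v => ?_⟩
  · simp [BoundedFormula.realize_all, hφ]
  · simp only [BoundedFormula.realize_all, hφ' M hM, Fin.snoc_last, Fin.snoc_castSucc]
    -- Transitivity puts every element of `v i` into `M`, so quantifying over `M` loses nothing.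
    exact ⟨fun h x hx => h ⟨x, hM _ (v i).2 _ hx⟩ hx, fun h x hx => h x hx⟩

theorem bex {P : (Fin n → ZFSet.{u}) → ZFSet.{u} → Prop} (i : Fin n)
    (hP : IsAbsolute fun w : Fin (n + 1) → ZFSet.{u} =>
      P (fun k => w k.castSucc) (w (Fin.last n))) :
    IsAbsolute fun v => ∃ x ∈ v i, P v x :=
  (ball (P := fun v x => ¬ P v x) i hP.not).not.congr fun v => by push Not; rfl

theorem eq_pair (i k l : Fin n) :
    IsAbsolute fun v : Fin n → ZFSet.{u} => v i = ZFSet.pair (v k) (v l) := by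
  have h : IsAbsolute fun v : Fin n → ZFSet.{u} =>
      ∃ s ∈ v i, ∃ t ∈ v i, (v k ∈ s ∧ ∀ x ∈ s, x = v k) ∧
        (v k ∈ t ∧ v l ∈ t ∧ ∀ x ∈ t, x = v k ∨ x = v l) ∧ ∀ x ∈ v i, x = s ∨ x = t := by
    refine bex _ (bex _ (and (and (mem _ _) (ball _ (eq _ _))) (and (and (mem _ _) (and (mem _ _)
      (ball _ (or (eq _ _) (eq _ _))))) (ball _ (or (eq _ _) (eq _ _))))))
  refine h.congr fun v => ?_
  constructor
  · intro h
    refine ⟨{v k}, ?_, {v k, v l}, ?_, ?_⟩ <;> simp [h, ZFSet.pair]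
  · rintro ⟨s, hs, t, ht, ⟨h1, h2⟩, ⟨h3, h4, h5⟩, h6⟩
    have es : s = {v k} := by
      ext x
      rw [ZFSet.mem_singleton]
      exact ⟨h2 x, fun h => h ▸ h1⟩
    have et : t = {v k, v l} := by
      ext x
      rw [ZFSet.mem_pair]
      exact ⟨h5 x, fun h => h.elim (fun h => h ▸ h3) fun h => h ▸ h4⟩
    ext x
    rw [ZFSet.pair, ZFSet.mem_pair, ← es, ← et]
    exact ⟨h6 x, fun h => h.elim (fun h => h ▸ hs) fun h => h ▸ ht⟩

theorem eq_inter (i k l : Fin n) :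
    IsAbsolute fun v : Fin n → ZFSet.{u} => v i = v k ∩ v l := by
  have h : IsAbsolute fun v : Fin n → ZFSet.{u} =>
      (∀ x ∈ v i, x ∈ v k ∧ x ∈ v l) ∧ ∀ x ∈ v k, x ∈ v l → x ∈ v i :=
    and (ball _ (and (mem _ _) (mem _ _))) (ball _ (imp (mem _ _) (mem _ _)))
  refine h.congr fun v => ?_
  simp only [ZFSet.ext_iff, ZFSet.mem_inter]
  grind

theorem eq_succ (i k : Fin n) :
    IsAbsolute fun v : Fin n → ZFSet.{u} => v i = insert (v k) (v k) := by
  have h : IsAbsolute fun v : Fin n → ZFSet.{u} =>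
      (∀ x ∈ v i, x = v k ∨ x ∈ v k) ∧ v k ∈ v i ∧ ∀ x ∈ v k, x ∈ v i :=
    and (ball _ (or (eq _ _) (mem _ _))) (and (mem _ _) (ball _ (mem _ _)))
  refine h.congr fun v => ?_
  rw [ZFSet.ext_iff]
  simp only [ZFSet.mem_insert_iff]
  grind

theorem eq_empty (i : Fin n) : IsAbsolute fun v : Fin n → ZFSet.{u} => v i = ∅ := by
  have h : IsAbsolute fun v : Fin n → ZFSet.{u} => ∀ x ∈ v i, ¬ x = x :=
    ball _ (not (eq _ _))
  refine h.congr fun v => ?_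
  simp [ZFSet.eq_empty]

theorem isTransitive (i : Fin n) :
    IsAbsolute fun v : Fin n → ZFSet.{u} => (v i).IsTransitive := by
  have h : IsAbsolute fun v : Fin n → ZFSet.{u} => ∀ x ∈ v i, ∀ y ∈ x, y ∈ v i :=
    ball _ (ball _ (mem _ _))
  exact h

/-- The coordinates of a Kuratowski pair `z` both lie in its element `{x, y}`, so two nested bounded
quantifiers reach them. -/
theorem isFunction (i : Fin n) :
    IsAbsolute fun v : Fin n → ZFSet.{u} => IsFunction (v i) := by
  have h : IsAbsolute fun v : Fin n → ZFSet.{u} =>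
      (∀ z ∈ v i, ∃ t ∈ z, ∃ x ∈ t, ∃ y ∈ t, z = ZFSet.pair x y) ∧
      ∀ z ∈ v i, ∀ t ∈ z, ∀ x ∈ t, ∀ y ∈ t, ∀ z' ∈ v i, ∀ t' ∈ z', ∀ y' ∈ t',
        z = ZFSet.pair x y → z' = ZFSet.pair x y' → y = y' :=
    and (ball _ (bex _ (bex _ (bex _ (eq_pair _ _ _)))))
      (ball _ (ball _ (ball _ (ball _ (ball _ (ball _ (ball _
        (imp (eq_pair _ _ _) (imp (eq_pair _ _ _) (eq _ _))))))))))
  refine h.congr fun v => and_congr ?_ ?_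
  · refine forall₂_congr fun z _ => ⟨?_, ?_⟩
    · rintro ⟨x, y, rfl⟩
      exact ⟨{x, y}, by simp [ZFSet.pair], x, by simp, y, by simp, rfl⟩
    · rintro ⟨t, -, x, -, y, -, h⟩
      exact ⟨x, y, h⟩
  · constructor
    · rintro h z hz t - x - y - z' hz' t' - y' - rfl rfl
      exact h x y y' hz hz'
    · intro h x y y' hy hy'
      exact h _ hy {x, y} (by simp [ZFSet.pair]) x (by simp) y (by simp) _ hy' {x, y'}
        (by simp [ZFSet.pair]) y' (by simp) rfl rfl

/-- Elementary embeddings into transitive classes preserve absolute predicates. -/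
theorem map_iff (hP : IsAbsolute P) {M : Set ZFSet.{u}} (hM : ∀ x ∈ M, ∀ y ∈ x, y ∈ M)
    (j : ZFSet.{u} ↪ₑ[setLang] M) (v : Fin n → ZFSet.{u}) :
    P (fun i => (j (v i) : ZFSet.{u})) ↔ P v := by
  obtain ⟨φ, hφ, hφ'⟩ := hP
  rw [← hφ' M hM fun i => j (v i), ← hφ, ← j.map_boundedFormula φ Empty.elim v,
    Subsingleton.elim (j ∘ Empty.elim) Empty.elim]
  rfl

end IsAbsolute

/-- The elements of `s` all of whose elements meet `d`. For a function `s`, this is its restriction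
to `d`. -/
noncomputable def restrict (s d : ZFSet.{u}) : ZFSet.{u} :=
  ZFSet.sep (fun z => ∀ t ∈ z, ∃ x ∈ t, x ∈ d) s

/-- The elements of the pair are `{x}` and `{x, y}`. The first meets `d` exactly when `x ∈ d`, and
then so does the second. -/
theorem pair_mem_restrict {s d x y : ZFSet.{u}} :
    ZFSet.pair x y ∈ restrict s d ↔ ZFSet.pair x y ∈ s ∧ x ∈ d := by
  rw [restrict, ZFSet.mem_sep, ZFSet.pair]
  simp
  grind

theorem isAbsolute_eq_restrict {n : ℕ} (i k l : Fin n) :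
    IsAbsolute fun v : Fin n → ZFSet.{u} => v i = restrict (v k) (v l) := by
  open IsAbsolute in
  have h : IsAbsolute fun v : Fin n → ZFSet.{u} =>
      (∀ z ∈ v i, z ∈ v k ∧ ∀ t ∈ z, ∃ x ∈ t, x ∈ v l) ∧
      ∀ z ∈ v k, (∀ t ∈ z, ∃ x ∈ t, x ∈ v l) → z ∈ v i :=
    and (ball _ (and (mem _ _) (ball _ (bex _ (mem _ _)))))
      (ball _ (imp (ball _ (bex _ (mem _ _))) (mem _ _)))
  refine h.congr fun v => ?_
  simp only [ZFSet.ext_iff, restrict, ZFSet.mem_sep]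
  grind

/-- A transitive class that `V` embeds into elementarily is closed under restriction of
functions. -/
theorem restrict_mem {M : Set ZFSet.{u}} (hM : ∀ x ∈ M, ∀ y ∈ x, y ∈ M)
    (j : ZFSet.{u} ↪ₑ[setLang] M) {s d : ZFSet.{u}} (hs : s ∈ M) (hd : d ∈ M) :
    restrict s d ∈ M := by
  obtain ⟨φ, hφ, hφ'⟩ := isAbsolute_eq_restrict.{u} (2 : Fin 3) 0 1
  have hV : φ.ex.all.all.Realize (Empty.elim : Empty → ZFSet.{u}) Fin.elim0 := by
    simp only [BoundedFormula.realize_all, BoundedFormula.realize_ex, hφ]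
    exact fun s d => ⟨restrict s d, rfl⟩
  rw [← j.map_boundedFormula, Subsingleton.elim (j ∘ Empty.elim) Empty.elim] at hV
  simp only [BoundedFormula.realize_all, BoundedFormula.realize_ex, hφ' M hM] at hV
  obtain ⟨r, hr⟩ := hV ⟨s, hs⟩ ⟨d, hd⟩
  have hr' : (r : ZFSet.{u}) = restrict s d := hr
  exact hr' ▸ r.2

/-! ### Supercompactness embeddings -/

theorem toZFSet_mem_cardSet {κ : Cardinal.{u}} {o : Ordinal.{u}} :
    o.toZFSet ∈ cardSet κ ↔ o < κ.ord :=
  Ordinal.toZFSet_mem_toZFSet_iff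

/-- A finite ordinal cannot be the critical point: `∅` is absolute, and so is the successor of an
ordinal that is already fixed. -/
theorem IsSupercompactnessEmbedding.aleph0_le {κ θ : Cardinal.{u}} {M : Set ZFSet.{u}}
    {j : ZFSet.{u} ↪ₑ[setLang] M} (hj : IsSupercompactnessEmbedding κ θ M j) : ℵ₀ ≤ κ := by
  by_contra! hκ
  obtain ⟨n, rfl⟩ := Cardinal.lt_aleph0.1 hκ
  apply hj.move
  cases n with
  | zero =>
    have h := (IsAbsolute.eq_empty.{u} (0 : Fin 1)).map_iff hj.transitive j fun _ => ∅
    simpa [cardSet] using h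
  | succ m =>
    have h := (IsAbsolute.eq_succ.{u} (0 : Fin 2) 1).map_iff hj.transitive j
      ![cardSet (m + 1 : ℕ), (m : Ordinal.{u}).toZFSet]
    have hm := hj.fix m (by rw [Cardinal.ord_natCast]; exact_mod_cast m.lt_succ_self)
    have e : cardSet.{u} (m + 1 : ℕ) =
        insert (m : Ordinal.{u}).toZFSet (m : Ordinal.{u}).toZFSet := by
      rw [cardSet, Cardinal.ord_natCast, Nat.cast_succ, Ordinal.toZFSet_add_one]
    simp only [Matrix.cons_val_zero, Matrix.cons_val_one, hm] at h
    rw [h.2 e, e]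

theorem IsSupercompactnessEmbedding.isTransitive_image {κ θ : Cardinal.{u}} {M : Set ZFSet.{u}}
    {j : ZFSet.{u} ↪ₑ[setLang] M} (hj : IsSupercompactnessEmbedding κ θ M j) :
    (j (cardSet κ) : ZFSet.{u}).IsTransitive :=
  ((IsAbsolute.isTransitive.{u} (0 : Fin 1)).map_iff hj.transitive j fun _ => cardSet κ).2
    (ZFSet.isOrdinal_toZFSet _).isTransitive

theorem IsSupercompactnessEmbedding.cardSet_mem_image {κ θ μ : Cardinal.{u}} {M : Set ZFSet.{u}}
    {j : ZFSet.{u} ↪ₑ[setLang] M} (hj : IsSupercompactnessEmbedding κ θ M j) (hμ : μ ≤ θ) :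
    cardSet μ ∈ (j (cardSet κ) : ZFSet.{u}) := by
  rcases hμ.eq_or_lt with rfl | h
  · exact hj.lt_image
  · exact hj.isTransitive_image _ hj.lt_image (toZFSet_mem_cardSet.2 (Cardinal.ord_lt_ord.2 h))

/-- For closure, a `θ`-sequence is padded to a `θ'`-sequence by a constant, which puts it in `M`,
and is recovered there by restriction to `θ`. -/
theorem IsSupercompactnessEmbedding.mono {κ θ θ' : Cardinal.{u}} {M : Set ZFSet.{u}}
    {j : ZFSet.{u} ↪ₑ[setLang] M} (hj : IsSupercompactnessEmbedding κ θ' M j) (hκ : κ ≤ θ)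
    (hθ : θ ≤ θ') : IsSupercompactnessEmbedding κ θ M j where
  transitive := hj.transitive
  ordinals := hj.ordinals
  fix := hj.fix
  move := hj.move
  lt_image := hj.cardSet_mem_image hθ
  closed D s hD hs := by
    -- The padding value `d` is the sequence's value at `0`, which exists because `θ` is infinite.
    have h0 : (0 : Ordinal.{u}).toZFSet ∈ cardSet θ := by
      rw [toZFSet_mem_cardSet, Cardinal.ord_pos]
      exact Cardinal.aleph0_pos.trans_le (hj.aleph0_le.trans hκ)
    obtain ⟨d, hd, -⟩ := hs.2 _ h0
    have hdD : d ∈ D := (ZFSet.pair_mem_prod.1 (hs.1 hd)).2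
    have hsub : cardSet θ ⊆ cardSet θ' :=
      Ordinal.toZFSet_subset_toZFSet_iff.2 (Cardinal.ord_le_ord.2 hθ)
    have hdom {x y} (h : ZFSet.pair x y ∈ s) : x ∈ cardSet θ := (ZFSet.pair_mem_prod.1 (hs.1 h)).1
    have hmem : s ∪ (cardSet θ' \ cardSet θ).prod {d} ∈ M := by
      refine hj.closed D _ hD ⟨fun z hz => ?_, fun x hx => ?_⟩
      · rcases ZFSet.mem_union.1 hz with hz | hz
        · obtain ⟨a, ha, b, hb, rfl⟩ := ZFSet.mem_prod.1 (hs.1 hz)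
          exact ZFSet.pair_mem_prod.2 ⟨hsub ha, hb⟩
        · obtain ⟨a, ha, b, hb, rfl⟩ := ZFSet.mem_prod.1 hz
          rw [ZFSet.mem_singleton] at hb
          exact ZFSet.pair_mem_prod.2 ⟨(ZFSet.mem_sdiff.1 ha).1, hb ▸ hdD⟩
      · simp only [ZFSet.mem_union, ZFSet.pair_mem_prod, ZFSet.mem_sdiff, ZFSet.mem_singleton]
        by_cases hxθ : x ∈ cardSet θ
        · simpa [hxθ] using hs.2 x hxθ
        · exact ⟨d, by simp [hx, hxθ], fun y hy => hy.elim (fun h => absurd (hdom h) hxθ) (·.2)⟩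
    convert restrict_mem hj.transitive j hmem (hj.ordinals θ.ord) using 1
    ext z
    constructor
    · intro hz
      obtain ⟨a, ha, b, hb, rfl⟩ := ZFSet.mem_prod.1 (hs.1 hz)
      exact pair_mem_restrict.2 ⟨ZFSet.mem_union.2 (.inl hz), ha⟩
    · intro hz
      rcases ZFSet.mem_union.1 (ZFSet.sep_subset hz) with h | h
      · exact h
      · obtain ⟨a, ha, b, hb, rfl⟩ := ZFSet.mem_prod.1 h
        exact absurd (pair_mem_restrict.1 hz).2 (ZFSet.mem_sdiff.1 ha).2

theorem IsLaverFunction.aleph0_le {κ θ : Cardinal.{u}} {ℓ : ZFSet.{u}}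
    (hℓ : IsLaverFunction κ θ ℓ) : ℵ₀ ≤ κ := by
  obtain ⟨M, j, hj, -⟩ := hℓ.2 ∅ ⟨∅, ZFSet.isTransitive_empty, fun _ h => h, by simp⟩
  exact hj.aleph0_le

theorem InH.mono {μ ν : Cardinal.{u}} {x : ZFSet.{u}} (hx : InH μ x) (h : μ ≤ ν) : InH ν x :=
  let ⟨t, ht, hxt, hc⟩ := hx
  ⟨t, ht, hxt, hc.trans_le h⟩

theorem IsJointLaverSequence.mono {κ θ θ' : Cardinal.{u}} {Λ : Ordinal.{u}}
    {L : Set.Iio Λ → ZFSet.{u}} (hL : IsJointLaverSequence κ θ' Λ L) (hκ : κ ≤ θ) (hθ : θ ≤ θ') :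
    IsJointLaverSequence κ θ Λ L := by
  refine ⟨fun α => ⟨(hL.1 α).1, fun a ha => ?_⟩, fun a ha => ?_⟩
  · obtain ⟨M, j, hj, h⟩ := (hL.1 α).2 a (ha.mono (Order.succ_le_succ hθ))
    exact ⟨M, j, hj.mono hκ hθ, h⟩
  · obtain ⟨M, j, hj, h⟩ := hL.2 a fun α => (ha α).mono (Order.succ_le_succ hθ)
    exact ⟨M, j, hj.mono hκ hθ, h⟩

/-! ### Closure of `H_{θ⁺}` -/

section InH

variable {θ : Cardinal.{u}} {x y : ZFSet.{u}}

theorem InH.exists_mem (hθ : ℵ₀ ≤ θ) (hx : InH (Order.succ θ) x) :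
    ∃ t : ZFSet.{u}, t.IsTransitive ∧ x ∈ t ∧ t.card ≤ θ := by
  obtain ⟨t, ht, hxt, hc⟩ := hx
  rw [Order.lt_succ_iff] at hc
  refine ⟨insert x t, fun y hy z hz => ?_, ZFSet.mem_insert _ _,
    ZFSet.card_insert_le.trans (Cardinal.add_le_of_le hθ hc (one_le_aleph0.trans hθ))⟩
  rcases ZFSet.mem_insert_iff.1 hy with rfl | hy
  · exact ZFSet.mem_insert_of_mem _ (hxt hz)
  · exact ZFSet.mem_insert_of_mem _ (ht y hy hz)

theorem InH.range (hθ : ℵ₀ ≤ θ) {Λ : Ordinal.{u}} (hΛ : Λ.card ≤ θ) {F : Set.Iio Λ → ZFSet.{u}}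
    (hF : ∀ α, InH (Order.succ θ) (F α)) : InH (Order.succ θ) (ZFSet.range F) := by
  choose t ht hFt hc using fun α => (hF α).exists_mem hθ
  refine ⟨ZFSet.iUnion t, ZFSet.IsTransitive.iUnion ht, fun z hz => ?_, Order.lt_succ_iff.2 ?_⟩
  · obtain ⟨α, rfl⟩ := ZFSet.mem_range.1 hz
    exact ZFSet.mem_iUnion.2 ⟨α, hFt α⟩
  -- The index type `Set.Iio Λ` lives one universe up, so the cardinalities are compared after
  -- lifting.
  · rw [← Cardinal.lift_le.{u + 1}]
    refine ZFSet.lift_card_iUnion_le_sum_card.trans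
      ((Cardinal.sum_le_sum _ (fun _ => θ) hc).trans ?_)
    rw [Cardinal.sum_const, Cardinal.mk_Iio_ordinal, Cardinal.lift_lift, ← Cardinal.lift_mul,
      Cardinal.lift_le]
    exact Cardinal.mul_le_of_le hθ hΛ le_rfl

theorem InH.insert_singleton (hθ : ℵ₀ ≤ θ) (hx : InH (Order.succ θ) x)
    (hy : InH (Order.succ θ) y) : InH (Order.succ θ) {x, y} := by
  obtain ⟨s, hs, hxs, hsc⟩ := hx.exists_mem hθ
  obtain ⟨t, ht, hyt, htc⟩ := hy.exists_mem hθ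
  refine ⟨s ∪ t, hs.union ht, fun z hz => ?_,
    Order.lt_succ_iff.2 (ZFSet.card_union_le.trans (Cardinal.add_le_of_le hθ hsc htc))⟩
  rcases ZFSet.mem_pair.1 hz with rfl | rfl
  · exact ZFSet.mem_union.2 (.inl hxs)
  · exact ZFSet.mem_union.2 (.inr hyt)

theorem InH.pair (hθ : ℵ₀ ≤ θ) (hx : InH (Order.succ θ) x) (hy : InH (Order.succ θ) y) :
    InH (Order.succ θ) (ZFSet.pair x y) := by
  rw [ZFSet.pair, ← ZFSet.pair_eq_singleton x]
  exact (hx.insert_singleton hθ hx).insert_singleton hθ (hx.insert_singleton hθ hy)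

theorem InH.of_subset_cardSet {κ : Cardinal.{u}} (hκ : κ ≤ θ) (hx : x ⊆ cardSet κ) :
    InH (Order.succ θ) x :=
  ⟨cardSet κ, (ZFSet.isOrdinal_toZFSet _).isTransitive, hx, by
    simpa [cardSet, Order.lt_succ_iff] using hκ⟩

end InH

/-! ### Slices of a Laver function -/

theorem eval_eq {g x y : ZFSet.{u}} (hg : IsFunction g) (h : ZFSet.pair x y ∈ g) :
    eval g x = y := by
  have hd : IsFunction g ∧ ∃ y, ZFSet.pair x y ∈ g := ⟨hg, y, h⟩
  rw [eval, dif_pos hd]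
  exact hg.2 _ _ _ hd.2.choose_spec h

theorem eval_eq_empty_or (g x : ZFSet.{u}) : eval g x = ∅ ∨ ZFSet.pair x (eval g x) ∈ g := by
  by_cases hd : IsFunction g ∧ ∃ y, ZFSet.pair x y ∈ g
  · rw [eval, dif_pos hd]
    exact .inr hd.2.choose_spec
  · rw [eval, dif_neg hd]
    exact .inl rfl

theorem eval_mem_of_isTransitive {t g x : ZFSet.{u}} (ht : t.IsTransitive) (h0 : ∅ ∈ t)
    (hg : g ∈ t) : eval g x ∈ t := by
  rcases eval_eq_empty_or g x with h | h
  · rwa [h]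
  -- Descend along `eval g x ∈ {x, eval g x} ∈ pair x (eval g x) ∈ g ∈ t`.
  · refine ht {x, eval g x} (ht _ (ht _ hg h) ?_) ?_ <;> simp [ZFSet.pair]

theorem isFunction_of_isFunc {x y f : ZFSet.{u}} (hf : ZFSet.IsFunc x y f) : IsFunction f := by
  refine ⟨fun z hz => ?_, fun a b b' h h' => ?_⟩
  · obtain ⟨a, -, b, -, rfl⟩ := ZFSet.mem_prod.1 (hf.1 hz)
    exact ⟨a, b, rfl⟩
  · exact (hf.2 a (ZFSet.pair_mem_prod.1 (hf.1 h)).1).unique h h'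

theorem pair_mem_slice {κ : Cardinal.{u}} {ℓ A : ZFSet.{u}} {ξ : ZFSet.{u}} (hξ : ξ ∈ cardSet κ) :
    ZFSet.pair ξ (eval (eval ℓ ξ) (A ∩ ξ)) ∈ slice κ ℓ A := by
  obtain ⟨o, ho, rfl⟩ := Ordinal.mem_toZFSet_iff.1 hξ
  exact ZFSet.mem_range.2 ⟨⟨o, ho⟩, rfl⟩

theorem isFunc_slice {κ : Cardinal.{u}} {ℓ : ZFSet.{u}} (A : ZFSet.{u})
    (hℓ : ZFSet.IsFunc (cardSet κ) (ZFSet.vonNeumann κ.ord) ℓ) :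
    ZFSet.IsFunc (cardSet κ) (ZFSet.vonNeumann κ.ord) (slice κ ℓ A) := by
  refine ⟨fun z hz => ?_, fun ξ hξ => ⟨_, pair_mem_slice hξ, fun y hy => ?_⟩⟩
  · obtain ⟨⟨o, ho⟩, rfl⟩ := ZFSet.mem_range.1 hz
    have ho' : o.toZFSet ∈ cardSet κ := toZFSet_mem_cardSet.2 ho
    refine ZFSet.pair_mem_prod.2 ⟨ho', ?_⟩
    obtain ⟨g, hg, -⟩ := hℓ.2 _ ho'
    rw [eval_eq (isFunction_of_isFunc hℓ) hg]
    refine eval_mem_of_isTransitive (ZFSet.isTransitive_vonNeumann _) ?_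
      (ZFSet.pair_mem_prod.1 (hℓ.1 hg)).2
    rw [ZFSet.mem_vonNeumann, ZFSet.rank_empty]
    exact zero_le.trans_lt ho
  · obtain ⟨o, ho⟩ := ZFSet.mem_range.1 hy
    obtain ⟨rfl, rfl⟩ := ZFSet.pair_injective ho
    rfl

/-- The defining property of `slice κ ℓ A`, as a predicate of `ℓ`, the slice, `A` and `κ`. -/
def SliceSpec (ℓ s A k : ZFSet.{u}) : Prop :=
  ∀ z ∈ ℓ, ∀ ξ ∈ k, ∀ t ∈ z, ∀ g ∈ t, z = ZFSet.pair ξ g → IsFunction g →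
    ∀ z' ∈ g, ∀ t' ∈ z', ∀ y ∈ t', ∀ B ∈ t', z' = ZFSet.pair B y → B = A ∩ ξ →
      ∃ w ∈ s, w = ZFSet.pair ξ y

theorem isAbsolute_sliceSpec :
    IsAbsolute fun v : Fin 4 → ZFSet.{u} => SliceSpec (v 0) (v 1) (v 2) (v 3) := by
  unfold SliceSpec
  open IsAbsolute in
  exact ball _ (ball _ (ball _ (ball _ (imp (eq_pair _ _ _) (imp (isFunction _)
    (ball _ (ball _ (ball _ (ball _ (imp (eq_pair _ _ _) (imp (eq_inter _ _ _)
      (bex _ (eq_pair _ _ _)))))))))))))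

theorem SliceSpec.pair_mem {ℓ s A k ξ g y : ZFSet.{u}} (h : SliceSpec ℓ s A k) (hξ : ξ ∈ k)
    (hℓ : ZFSet.pair ξ g ∈ ℓ) (hg : IsFunction g) (hy : ZFSet.pair (A ∩ ξ) y ∈ g) :
    ZFSet.pair ξ y ∈ s := by
  -- The unordered pairs `{ξ, g}` and `{A ∩ ξ, y}` serve only as bounds for the quantifiers over
  -- coordinates.
  obtain ⟨w, hw, rfl⟩ := h _ hℓ ξ hξ {ξ, g} (by simp [ZFSet.pair]) g (by simp) rfl hg _ hy
    {A ∩ ξ, y} (by simp [ZFSet.pair]) y (by simp) _ (by simp) rfl rfl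
  exact hw

/-- Only the case where the evaluation succeeds is recorded. The default value `∅` never matters for
guessing. -/
theorem sliceSpec_slice {κ : Cardinal.{u}} {ℓ : ZFSet.{u}} (A : ZFSet.{u}) (hℓ : IsFunction ℓ) :
    SliceSpec ℓ (slice κ ℓ A) A (cardSet κ) := by
  rintro _ hz ξ hξ _ - g - rfl hg _ hz' _ - y - B - rfl rfl
  refine ⟨_, ?_, rfl⟩
  have h := pair_mem_slice (ℓ := ℓ) (A := A) hξ
  rwa [eval_eq hℓ hz, eval_eq hg hz'] at h

/-- For `o < κ`, `j(o) = o`, so `o ∈ j(A)` if and only if `o ∈ A`. -/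
theorem IsSupercompactnessEmbedding.image_inter {κ θ : Cardinal.{u}} {M : Set ZFSet.{u}}
    {j : ZFSet.{u} ↪ₑ[setLang] M} (hj : IsSupercompactnessEmbedding κ θ M j) {A : ZFSet.{u}}
    (hA : A ⊆ cardSet κ) : (j A : ZFSet.{u}) ∩ cardSet κ = A := by
  have key (o : Ordinal.{u}) (ho : o < κ.ord) : o.toZFSet ∈ (j A : ZFSet.{u}) ↔ o.toZFSet ∈ A := by
    have h := (IsAbsolute.mem.{u} (0 : Fin 2) 1).map_iff hj.transitive j ![o.toZFSet, A]
    simpa [hj.fix o ho] using h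
  ext x
  rw [ZFSet.mem_inter]
  constructor
  · rintro ⟨hx, hxκ⟩
    obtain ⟨o, ho, rfl⟩ := Ordinal.mem_toZFSet_iff.1 hxκ
    exact (key o ho).1 hx
  · intro hx
    obtain ⟨o, ho, rfl⟩ := Ordinal.mem_toZFSet_iff.1 (hA hx)
    exact ⟨(key o ho).2 hx, hA hx⟩

/-- If `j(ℓ)(κ)` is a function with value `y` at `A ⊆ κ`, then the slice of `ℓ` at `A` guesses
`y`. -/
theorem guesses_slice {κ θ : Cardinal.{u}} {M : Set ZFSet.{u}}
    {j : ZFSet.{u} ↪ₑ[setLang] M} (hj : IsSupercompactnessEmbedding κ θ M j) (hκ : κ ≤ θ)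
    {ℓ A g y : ZFSet.{u}} (hℓ : IsFunction ℓ) (hA : A ⊆ cardSet κ) (hG : Guesses κ j ℓ g)
    (hg : IsFunction g) (hy : ZFSet.pair A y ∈ g) : Guesses κ j (slice κ ℓ A) y := by
  have h : SliceSpec (j ℓ : ZFSet.{u}) (j (slice κ ℓ A)) (j A) (j (cardSet κ)) :=
    (isAbsolute_sliceSpec.{u}.map_iff hj.transitive j ![ℓ, slice κ ℓ A, A, cardSet κ]).2
      (sliceSpec_slice A hℓ)
  -- Since `κ ∈ j(κ)`, the transferred property may be applied at `ξ = κ`.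
  refine h.pair_mem (hj.cardSet_mem_image hκ) hG hg ?_
  rwa [hj.image_inter hA]

theorem isJointLaverSequence_slice {κ θ : Cardinal.{u}} (hκ : κ ≤ θ) {ℓ : ZFSet.{u}}
    (hℓ : IsLaverFunction κ θ ℓ) {Λ : Ordinal.{u}} (hΛ : Λ.card ≤ θ) {f : Set.Iio Λ → ZFSet.{u}}
    (hf : Function.Injective f) (hfκ : ∀ α, f α ⊆ cardSet κ) :
    IsJointLaverSequence κ θ Λ fun α => slice κ ℓ (f α) := by
  have hθ : ℵ₀ ≤ θ := hℓ.aleph0_le.trans hκ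
  have hjoint (a : Set.Iio Λ → ZFSet.{u}) (ha : ∀ α, InH (Order.succ θ) (a α)) :
      ∃ (M : Set ZFSet.{u}) (j : ZFSet.{u} ↪ₑ[setLang] M),
        IsSupercompactnessEmbedding κ θ M j ∧ ∀ α, Guesses κ j (slice κ ℓ (f α)) (a α) := by
    have hg : IsFunction (ZFSet.range fun α => ZFSet.pair (f α) (a α)) := by
      refine ⟨fun z hz => ?_, fun x y y' h h' => ?_⟩
      · obtain ⟨α, rfl⟩ := ZFSet.mem_range.1 hz
        exact ⟨_, _, rfl⟩
      · obtain ⟨α, hα⟩ := ZFSet.mem_range.1 h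
        obtain ⟨β, hβ⟩ := ZFSet.mem_range.1 h'
        obtain ⟨rfl, rfl⟩ := ZFSet.pair_injective hα
        obtain ⟨e, rfl⟩ := ZFSet.pair_injective hβ
        -- Single-valuedness of the coded target is where injectivity of `f` enters.
        rw [hf e]
    obtain ⟨M, j, hj, hG⟩ := hℓ.2 _ (InH.range hθ hΛ fun α =>
      (InH.of_subset_cardSet hκ (hfκ α)).pair hθ (ha α))
    exact ⟨M, j, hj, fun α => guesses_slice hj hκ (isFunction_of_isFunc hℓ.1) (hfκ α) hG hg
      (ZFSet.mem_range.2 ⟨α, rfl⟩)⟩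
  refine ⟨fun α => ⟨isFunc_slice _ hℓ.1, fun a ha => ?_⟩, hjoint⟩
  -- Each slice is itself a Laver function: apply joint guessing to the constant sequence of
  -- targets.
  obtain ⟨M, j, hj, h⟩ := hjoint (fun _ => a) fun _ => ha
  exact ⟨M, j, hj, h α⟩

theorem exists_injective_subset_cardSet {κ μ : Cardinal.{u}} (hμ : μ ≤ 2 ^ κ) :
    ∃ f : Set.Iio μ.ord → ZFSet.{u}, Function.Injective f ∧ ∀ α, f α ⊆ cardSet κ := by
  have h : #(Set.Iio μ.ord) ≤ #((cardSet κ).powerset) := by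
    rw [ZFSet.cardinalMk_coe_sort, ZFSet.card_powerset, Cardinal.mk_Iio_ordinal, Cardinal.lift_le]
    simpa [cardSet] using hμ
  obtain ⟨e⟩ := Cardinal.le_def _ _ |>.1 h
  exact ⟨fun α => e α, Subtype.val_injective.comp e.injective, fun α =>
    ZFSet.mem_powerset.1 (e α).2⟩

end JointLaver

theorem proposition3p2 (κ : Cardinal.{u}) :
    -- A `θ`-supercompactness Laver function yields a joint Laver sequence of length
    -- `min {θ, 2 ^ κ}`.
    (∀ θ : Cardinal.{u}, κ ≤ θ → (∃ ℓ : ZFSet.{u}, JointLaver.IsLaverFunction κ θ ℓ) →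
      ∃ L : Set.Iio (min θ (2 ^ κ)).ord → ZFSet.{u},
        JointLaver.IsJointLaverSequence κ θ (min θ (2 ^ κ)).ord L) ∧
    -- Explicitly, `ℓ_α(ξ) = ℓ(ξ)(f(α) ∩ ξ)` is such a sequence.
    (∀ θ : Cardinal.{u}, κ ≤ θ → ∀ ℓ : ZFSet.{u}, JointLaver.IsLaverFunction κ θ ℓ →
      ∀ f : Set.Iio (min θ (2 ^ κ)).ord → ZFSet.{u}, Function.Injective f →
        (∀ α, f α ⊆ JointLaver.cardSet κ) →
        JointLaver.IsJointLaverSequence κ θ (min θ (2 ^ κ)).ord (fun α => JointLaver.slice κ ℓ (f α))) ∧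
    -- A Laver function for all degrees yields a sequence of length `2 ^ κ` for all degrees.
    ((∃ ℓ : ZFSet.{u}, ∀ θ : Cardinal.{u}, κ ≤ θ → JointLaver.IsLaverFunction κ θ ℓ) →
      ∃ L : Set.Iio ((2 : Cardinal.{u}) ^ κ).ord → ZFSet.{u},
        ∀ θ : Cardinal.{u}, κ ≤ θ →
          JointLaver.IsJointLaverSequence κ θ ((2 : Cardinal.{u}) ^ κ).ord L) := by
  have hcard (θ : Cardinal.{u}) : (min θ (2 ^ κ)).ord.card ≤ θ := by simp
  refine ⟨fun θ hκ ⟨ℓ, hℓ⟩ => ?_, fun θ hκ ℓ hℓ f hf hfκ =>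
    JointLaver.isJointLaverSequence_slice hκ hℓ (hcard θ) hf hfκ, fun ⟨ℓ, hℓ⟩ => ?_⟩
  · obtain ⟨f, hf, hfκ⟩ := JointLaver.exists_injective_subset_cardSet (min_le_right θ (2 ^ κ))
    exact ⟨_, JointLaver.isJointLaverSequence_slice hκ hℓ (hcard θ) hf hfκ⟩
  · obtain ⟨f, hf, hfκ⟩ := JointLaver.exists_injective_subset_cardSet (le_refl (2 ^ κ))
    refine ⟨fun α => JointLaver.slice κ ℓ (f α), fun θ hκ => ?_⟩
    -- The length `2 ^ κ` may exceed `θ`, so the coding is done at a degree that bounds both.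
    have hmax : κ ≤ max θ (2 ^ κ) := hκ.trans (le_max_left _ _)
    exact (JointLaver.isJointLaverSequence_slice hmax (hℓ _ hmax) (by simp) hf hfκ).mono hκ
      (le_max_left _ _)
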